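/- Let $\mathrm{Sym}$ be a set of symbols and $\mathrm{Sym}^*$ the set of finite lists (paths) of symbols. A finite set $U\subset \mathrm{Sym}^*$ is prefix-free if no element of $U$ is a prefix of a different element of $U$. A directory in a class $X$ is a pair $(U,x)$ with $U$ a finite prefix-free subset of $\mathrm{Sym}^*$ and $x\colon U\to X$; directories form the monad $\mathsf{Dtry}$ on sets, with unit $x\mapsto(\{[\,]\},x)$ and with multiplication sending $(U,(V_n,x_n)_{n\in U})$ to the set $\{n\ast m : n\in U,\ m\in V_n\}$ of concatenated paths, with content $x_n(m)$ at $n\ast m$. For a category $\mathcal C$ let $\mathbf{Dtry}_0(\mathcal C)$ be the category whose objects are the directories of objects of $\mathcal C$ and whose morphisms are the directories of morphisms of $\mathcal C$ (so a morphism $(U,X)\to(U',X')$ exists only if $U=U'$, and is then a family $X(p)\to X'(p)$, $p\in U$). Let $\mathbf{FinFam}(\mathcal C)$ be the category of finite families $(X_i)_{i\in I}$ of objects of $\mathcal C$, a morphism $(X_i)_{i\in I}\to(Y_j)_{j\in J}$ being a function $f\colon I\to J$ with morphisms $X_i\to Y_{f(i)}$, and let $\mathrm{PathFamily}\colon\mathbf{Dtry}_0(\mathcal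 C)\to\mathbf{FinFam}(\mathcal C)$ send $(U,X)$ to $(X(p))_{p\in U}$. Let $\mathbf{Dtry}(\mathcal C)$ be the middle category of the factorization of $\mathrm{PathFamily}$ into a bijective-on-objects functor followed by a fully faithful functor: its objects are directories of objects of $\mathcal C$, and a morphism $(U,X)\to(U',X')$ is a function $f_0\colon U\to U'$ with morphisms $f_1(p)\colon X(p)\to X'(f_0(p))$ for $p\in U$. **Theorem.** The assignment $\mathcal C\mapsto\mathbf{Dtry}(\mathcal C)$ is the action on objects of a strict 2-monad on the 2-category $\mathbf{Cat}$, that is, of a strict 2-functor $T$ with strictly 2-natural transformations $\eta\colon 1\Rightarrow T$, $\mu\colon T^2\Rightarrow T$ satisfying the monad laws as equalities. Its operations are the following: a functor $F$ acts by $(U,X)\mapsto(U,F\circ X)$ and $(f_0,f_1)\mapsto(f_0,F(f_1))$; a natural transformation $\alpha$ acts by the morphisms $(\mathrm{id}_U,(\alpha_{X(p)})_{p\in U})$; $\eta$ and $\mu$ are given on objects by the unit and multiplication of $\mathsf{Dtry}$, $\eta$ sends a morphism $f$ to $(\mathrm{id},f)$, and $\mu$ sends a morphism $g=(g_0,g_1)$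 with $g_1(n)=(g_{1}(n)_0,g_1(n)_1)$ to the morphism $n\ast m\mapsto g_0(n)\ast g_1(n)_0(m)$ with component $g_1(n)_1(m)$ at $n\ast m$. Moreover, let $\mathrm{Sym}$ be equipped with a linear order, let $\mathbf{FinFam}_=(\mathcal C)$ be the full subcategory of $\mathbf{FinFam}(\mathcal C)$ on the families indexed by standard $n$-element sets, $n\in\mathbb N$, and let $\mathbf{Dtry}_0(\mathcal C)\to\mathbf{FinFam}_=(\mathcal C)$ be the functor obtained from $\mathrm{PathFamily}$ by listing the paths of each directory in lexicographic order. Then the bo-ff factorization of this functor gives the same category: there is an isomorphism of categories from $\mathbf{Dtry}(\mathcal C)$ to its middle category that commutes with the bijective-on-objects functors from $\mathbf{Dtry}_0(\mathcal C)$ and, up to natural isomorphism, with the fully faithful functors to $\mathbf{FinFam}(\mathcal C)$. -/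

import Mathlib

open CategoryTheory Bicategory Limits

universe w v v₁ u u₁

noncomputable section

/-! ## Strict 2-monads on a strict 2-category -/

/-- A (strict) 2-natural transformation between strict 2-functors: components that are strictly
natural with respect to 1-cells and compatible with 2-cells. -/
structure StrictTwoNatTrans {B : Type u} [Bicategory.{w, v} B] [Strict B]
    (F G : StrictPseudofunctor B B) where
  app (a : B) : F.obj a ⟶ G.obj a
  naturality {a b : B} (f : a ⟶ b) : F.map f ≫ app b = app a ≫ G.map f
  naturality₂ {a b : B} {f g : a ⟶ b} (α : f ⟶ g) :
    F.map₂ α ▷ app b =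
      eqToHom (naturality f) ≫ app a ◁ G.map₂ α ≫ eqToHom (naturality g).symm

/-- A (strict) 2-monad on a strict 2-category: a strict 2-functor with 2-natural unit and
multiplication satisfying the monad laws on the nose. -/
structure StrictTwoMonad (B : Type u) [Bicategory.{w, v} B] [Strict B] where
  functor : StrictPseudofunctor B B
  unit : StrictTwoNatTrans (StrictPseudofunctor.id B) functor
  mult : StrictTwoNatTrans (functor.comp functor) functor
  unit_mult (a : B) :
    (unit.app (functor.obj a) : functor.obj a ⟶ functor.obj (functor.obj a)) ≫
      (mult.app a : functor.obj (functor.obj a) ⟶ functor.obj a) = 𝟙 (functor.obj a)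
  map_unit_mult (a : B) :
    functor.map (unit.app a : a ⟶ functor.obj a) ≫
      (mult.app a : functor.obj (functor.obj a) ⟶ functor.obj a) = 𝟙 (functor.obj a)
  mult_mult (a : B) :
    (mult.app (functor.obj a) :
        functor.obj (functor.obj (functor.obj a)) ⟶ functor.obj (functor.obj a)) ≫
      (mult.app a : functor.obj (functor.obj a) ⟶ functor.obj a) =
    functor.map (mult.app a : functor.obj (functor.obj a) ⟶ functor.obj a) ≫
      (mult.app a : functor.obj (functor.obj a) ⟶ functor.obj a)

/-- The bare operations of a 2-monad, without any laws. -/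
structure TwoMonadData (B : Type u) [Bicategory.{w, v} B] where
  obj : B → B
  map {a b : B} : (a ⟶ b) → (obj a ⟶ obj b)
  map₂ {a b : B} {f g : a ⟶ b} : (f ⟶ g) → (map f ⟶ map g)
  unit (a : B) : a ⟶ obj a
  mult (a : B) : obj (obj a) ⟶ obj a

/-- The operations underlying a 2-monad. -/
def StrictTwoMonad.data {B : Type u} [Bicategory.{w, v} B] [Strict B] (M : StrictTwoMonad B) :
    TwoMonadData B where
  obj := M.functor.obj
  map := M.functor.map
  map₂ := M.functor.map₂
  unit := M.unit.app
  mult := M.mult.app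

/-! ## The bo-ff factorization of a functor -/

section BoFF

variable {C : Type u} [Category.{v} C] {D : Type u₁} [Category.{v₁} D]

/-- The middle category of the bo-ff factorization of `F`: its objects are those of `C` (wrapped in a
structure), and `Hom X Y = Hom (F X) (F Y)`. -/
@[ext]
structure BoFF (F : C ⥤ D) where
  of ::
  obj : C

namespace BoFF

variable {F : C ⥤ D}

/-- Arrows of the middle category. -/
@[ext]
structure Hom (X Y : BoFF F) where
  hom : F.obj X.obj ⟶ F.obj Y.obj

instance : Category.{v₁} (BoFF F) where
  Hom := Hom
  id X := ⟨𝟙 (F.obj X.obj)⟩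
  comp f g := ⟨f.hom ≫ g.hom⟩

@[ext]
theorem hom_ext {X Y : BoFF F} {f g : X ⟶ Y} (h : f.hom = g.hom) : f = g := Hom.ext h

@[simp]
theorem id_hom (X : BoFF F) : (𝟙 X : X ⟶ X).hom = 𝟙 (F.obj X.obj) := rfl

@[simp]
theorem comp_hom {X Y Z : BoFF F} (f : X ⟶ Y) (g : Y ⟶ Z) : (f ≫ g).hom = f.hom ≫ g.hom := rfl

variable (F)

/-- The bijective-on-objects part. -/
def bo : C ⥤ BoFF F where
  obj X := ⟨X⟩
  map f := ⟨F.map f⟩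
  map_id _ := hom_ext (F.map_id _)
  map_comp _ _ := hom_ext (F.map_comp _ _)

/-- The fully faithful part. -/
def ff : BoFF F ⥤ D where
  obj X := F.obj X.obj
  map f := f.hom

/-- The two parts compose to `F`; the first is bijective on objects and the second fully faithful. -/
theorem bo_comp_ff : bo F ⋙ ff F = F := rfl

theorem bo_bijective : Function.Bijective (bo F).obj :=
  ⟨fun _ _ h => congrArg BoFF.obj h, fun X => ⟨X.obj, rfl⟩⟩

/-- The second part is fully faithful. -/
def ffFullyFaithful : (ff F).FullyFaithful where
  preimage f := ⟨f⟩

end BoFF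

end BoFF

/-! ## Finite families -/

/-- `FinFam C`: the full subcategory of the category `Fam C` of families of objects of `C` (Mathlib's
`FormalCoproduct`) on the families with a finite indexing set. -/
abbrev FinFam (C : Type u) [Category.{v} C] :=
  ObjectProperty.FullSubcategory (fun X : FormalCoproduct.{w} C => Finite X.I)

/-- A finite family. -/
abbrev FinFam.of {C : Type u} [Category.{v} C] {I : Type w} [Finite I] (X : I → C) :
    FinFam.{w} C := ⟨⟨I, X⟩, ‹Finite I›⟩

/-- A morphism of finite families: a function `f` on indices and arrows `X i ⟶ Y (f i)`. -/
abbrev FinFam.homMk {C : Type u} [Category.{v} C] {X Y : FinFam.{w} C}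
    (f : X.obj.I → Y.obj.I) (φ : ∀ i, X.obj.obj i ⟶ Y.obj.obj (f i)) : X ⟶ Y :=
  ObjectProperty.homMk (P := fun X : FormalCoproduct.{w} C => Finite X.I)
    (FormalCoproduct.Hom.mk f φ)

/-- Families of objects of `C` indexed by a standard set `{0, …, n - 1}`. -/
structure StdFamily (C : Type u) where
  n : ℕ
  val : Fin n → C

/-- A standard family, as a finite family. -/
def StdFamily.family {C : Type u} [Category.{v} C] (X : StdFamily C) : FinFam.{w} C :=
  FinFam.of (fun i : ULift.{w} (Fin X.n) => X.val i.down)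

/-- `FinFam₌ C`: the full subcategory of `FinFam C` on the standard families (with all morphisms of
families, not only the bijective ones). -/
abbrev FinFamEq (C : Type u) [Category.{v} C] :=
  InducedCategory (FinFam.{w} C) (StdFamily.family (C := C))

/-- The inclusion `FinFam₌ C ⥤ FinFam C`. -/
abbrev FinFamEq.incl (C : Type u) [Category.{v} C] : FinFamEq.{w} C ⥤ FinFam.{w} C :=
  inducedFunctor _

/-! ## The monad `Dtry` on sets -/

/-- A finite set of paths (lists of symbols) is prefix-free if no member is a proper prefix of
another member. -/
def PrefixFree {Sym : Type w} (U : Finset (List Sym)) : Prop :=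
  ∀ p ∈ U, ∀ q ∈ U, p <+: q → p = q

/-- A directory in `X`: a finite prefix-free set of complete paths, and an element of `X` at each of
them. This is the polynomial functor `∑ U, y ^ U`, `U` ranging over the finite prefix-free subsets
of `Sym*`; `DtryTree.toDtry_bijective`, `toDtry_map`, `toDtry_leaf` and `toDtry_flatten` below
identify it, as a monad, with the composite of `Maybe` and the free monad on nonempty records. -/
structure Dtry (Sym : Type w) (X : Type u) where
  dom : Finset (List Sym)
  prefixFree : PrefixFree dom
  val : dom → X

namespace Dtry

variable {Sym : Type w} {X : Type u}

theorem ext_val {Y Z : Dtry Sym X} (h : Y.dom = Z.dom)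
    (h' : ∀ p (hp : p ∈ Y.dom) (hp' : p ∈ Z.dom), Y.val ⟨p, hp⟩ = Z.val ⟨p, hp'⟩) : Y = Z := by
  obtain ⟨U, hU, y⟩ := Y
  obtain ⟨V, hV, z⟩ := Z
  obtain rfl : U = V := h
  obtain rfl : y = z := funext fun p => h' p.1 p.2 p.2
  rfl

/-- Apply a function to all contents of a directory. -/
abbrev map {X' : Type u₁} (F : X → X') (Y : Dtry Sym X) : Dtry Sym X' where
  dom := Y.dom
  prefixFree := Y.prefixFree
  val p := F (Y.val p)

/-- The unit: the directory whose only complete path is the empty one. -/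
abbrev pure (x : X) : Dtry Sym X where
  dom := {[]}
  prefixFree := by simp [PrefixFree]
  val _ := x

/-- Pairs of a complete path `n` of `Y` and a complete path `m` of the directory at `n`. -/
abbrev Pairs (Y : Dtry Sym (Dtry Sym X)) : Type w := Σ n : Y.dom, (Y.val n).dom

/-- Concatenation of paths. -/
def concat (Y : Dtry Sym (Dtry Sym X)) (x : Y.Pairs) : List Sym := x.1.1 ++ x.2.1

theorem concat_prefix (Y : Dtry Sym (Dtry Sym X)) {x y : Y.Pairs}
    (h : Y.concat x <+: Y.concat y) : x = y := by
  obtain ⟨⟨n, hn⟩, ⟨m, hm⟩⟩ := x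
  obtain ⟨⟨n', hn'⟩, ⟨m', hm'⟩⟩ := y
  have h : n ++ m <+: n' ++ m' := h
  have hnn : n = n' := by
    have h1 : n <+: n' ++ m' := (List.prefix_append n m).trans h
    rcases List.prefix_or_prefix_of_prefix h1 (List.prefix_append n' m') with h2 | h2
    · exact Y.prefixFree _ hn _ hn' h2
    · exact (Y.prefixFree _ hn' _ hn h2).symm
  subst hnn
  have h3 : m <+: m' := (List.prefix_append_right_inj n).1 h
  obtain rfl := (Y.val ⟨n, hn⟩).prefixFree _ hm _ hm' h3
  rfl

open scoped Classical in
/-- The multiplication: the paths are the concatenations `n ++ m`, and the content at `n ++ m` is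
the content at `m` of the directory at `n`. -/
def join (Y : Dtry Sym (Dtry Sym X)) : Dtry Sym X where
  dom := Finset.univ.image Y.concat
  prefixFree := by
    intro p hp q hq h
    obtain ⟨x, -, rfl⟩ := Finset.mem_image.1 hp
    obtain ⟨y, -, rfl⟩ := Finset.mem_image.1 hq
    rw [Y.concat_prefix h]
  val p :=
    let x := (Finset.mem_image.1 p.2).choose
    (Y.val x.1).val x.2

open scoped Classical in
/-- The bijection sending a path of `join Y` to the unique pair `(n, m)` that it is the
concatenation of. -/
def split (Y : Dtry Sym (Dtry Sym X)) : Y.join.dom ≃ Y.Pairs where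
  toFun p := (Finset.mem_image.1 p.2).choose
  invFun x := ⟨Y.concat x, Finset.mem_image_of_mem _ (Finset.mem_univ _)⟩
  left_inv p := Subtype.ext (Finset.mem_image.1 p.2).choose_spec.2
  right_inv x := Y.concat_prefix (by
    rw [(Finset.mem_image.1 (Finset.mem_image_of_mem Y.concat (Finset.mem_univ x))).choose_spec.2])

theorem split_symm_val (Y : Dtry Sym (Dtry Sym X)) (x : Y.Pairs) :
    (Y.split.symm x).1 = x.1.1 ++ x.2.1 := rfl

theorem join_val (Y : Dtry Sym (Dtry Sym X)) (p : Y.join.dom) :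
    Y.join.val p = (Y.val (Y.split p).1).val (Y.split p).2 := rfl

end Dtry

/-! ## Directories as trees -/

/-- The free monad on `Record_{≠∅} = ∑ y ^ U` (`U` ranging over the nonempty finite sets of symbols):
a tree is a leaf with a content, or a node with a nonempty finite set of named subtrees. -/
inductive DtryTree (Sym : Type w) (X : Type u) : Type (max w u)
  | leaf (x : X) : DtryTree Sym X
  | node (U : Finset Sym) (hU : U.Nonempty) (child : U → DtryTree Sym X) : DtryTree Sym X

namespace DtryTree

variable {Sym : Type w} {X : Type u} {Z : Type u₁}

open scoped Classical in
/-- The content at a complete path of a tree. -/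
def lookup : DtryTree Sym X → List Sym → Option X
  | leaf x, [] => some x
  | leaf _, _ :: _ => none
  | node _ _ _, [] => none
  | node U _ child, s :: p => if h : s ∈ U then (child ⟨s, h⟩).lookup p else none

/-- Substitution of trees for the contents of a tree (the free monad structure). -/
def bind (f : X → DtryTree Sym Z) : DtryTree Sym X → DtryTree Sym Z
  | leaf x => f x
  | node U hU child => node U hU (fun s => (child s).bind f)

open scoped Classical in
/-- The distributive law over `Maybe`: filter out the missing contents, and the subtrees that become
empty. -/
def distrib : DtryTree Sym (Option X) → Option (DtryTree Sym X)
  | leaf o => o.map leaf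
  | node U _ child =>
    if h : (U.filter (fun s => ∃ hs : s ∈ U, (child ⟨s, hs⟩).distrib.isSome)).Nonempty then
      some (node _ h (fun s => (child ⟨s.1, (Finset.mem_filter.1 s.2).1⟩).distrib.get
        (Finset.mem_filter.1 s.2).2.2))
    else none

/-- The content at a path of an element of `Maybe (DtryTree X)`. -/
def lookupMaybe (o : Option (DtryTree Sym X)) (p : List Sym) : Option X := o.bind (fun t => t.lookup p)

/-- The multiplication of the composite monad `Maybe ∘ DtryTree`. -/
def flatten (o : Option (DtryTree Sym (Option (DtryTree Sym X)))) : Option (DtryTree Sym X) :=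
  o.bind (fun t => t.distrib.map (fun t' => t'.bind id))

theorem lookup_finite (t : DtryTree Sym X) : {p | (t.lookup p).isSome}.Finite := by
  induction t with
  | leaf x =>
    refine (Set.finite_singleton ([] : List Sym)).subset ?_
    rintro (_ | ⟨s, p⟩) hp
    · rfl
    · simp [lookup] at hp
  | node U hU child ih =>
    refine (Set.finite_iUnion (fun s : U => (ih s).image (fun p => s.1 :: p))).subset ?_
    rintro (_ | ⟨s, p⟩) hp
    · simp [lookup] at hp
    · by_cases h : s ∈ U
      · simp only [Set.mem_ofPred_eq, lookup, h, dif_pos] at hp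
        exact Set.mem_iUnion.2 ⟨⟨s, h⟩, p, hp, rfl⟩
      · simp [lookup, h] at hp

theorem lookup_prefix (t : DtryTree Sym X) {p q : List Sym} (hp : (t.lookup p).isSome)
    (hq : (t.lookup q).isSome) (h : p <+: q) : p = q := by
  induction t generalizing p q with
  | leaf x => cases p <;> cases q <;> simp_all [lookup]
  | node U hU child ih =>
    rcases p with _ | ⟨s, p⟩
    · simp [lookup] at hp
    rcases q with _ | ⟨s', q⟩
    · simp at h
    obtain ⟨rfl, h'⟩ := List.cons_prefix_cons.1 h
    by_cases hs : s ∈ U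
    · simp only [lookup, hs, dif_pos] at hp hq
      rw [ih _ hp hq h']
    · simp [lookup, hs] at hp

theorem exists_lookup (t : DtryTree Sym X) : ∃ p, (t.lookup p).isSome := by
  induction t with
  | leaf x => exact ⟨[], rfl⟩
  | node U hU child ih =>
    obtain ⟨s, hs⟩ := hU
    obtain ⟨p, hp⟩ := ih ⟨s, hs⟩
    exact ⟨s :: p, by simpa [lookup, hs] using hp⟩

theorem lookup_injective {t t' : DtryTree Sym X} (h : ∀ p, t.lookup p = t'.lookup p) : t = t' := by
  induction t generalizing t' with
  | leaf x =>
    cases t' with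
    | leaf x' => simpa [lookup] using h []
    | node U hU child => simpa [lookup] using h []
  | node U hU child ih =>
    cases t' with
    | leaf x' => simpa [lookup] using h []
    | node V hV child' =>
      have key : ∀ (A B : Finset Sym) (c : A → DtryTree Sym X) (c' : B → DtryTree Sym X) hA hB,
          (∀ p, (node A hA c).lookup p = (node B hB c').lookup p) → A ⊆ B := by
        intro A B c c' hA hB hh s hs
        obtain ⟨p, hp⟩ := exists_lookup (c ⟨s, hs⟩)
        by_contra hs'
        have := hh (s :: p)
        simp only [lookup, hs, hs', dif_pos, dif_neg, not_false_eq_true] at this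
        simp [this] at hp
      obtain rfl : U = V := (key _ _ _ _ _ _ h).antisymm (key _ _ _ _ _ _ fun p => (h p).symm)
      congr 1
      funext s
      refine ih s fun p => ?_
      simpa [lookup] using h (s.1 :: p)

theorem exists_tree (N : ℕ) (φ : List Sym → Option X) (hN : ∀ p, (φ p).isSome → p.length ≤ N)
    (hfin : {p | (φ p).isSome}.Finite)
    (hpf : ∀ p q, (φ p).isSome → (φ q).isSome → p <+: q → p = q) (hne : ∃ p, (φ p).isSome) :
    ∃ t : DtryTree Sym X, ∀ p, t.lookup p = φ p := by
  classical
  induction N generalizing φ with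
  | zero =>
    obtain ⟨p, hp⟩ := hne
    obtain rfl : p = [] := List.length_eq_zero_iff.1 (Nat.le_zero.1 (hN p hp))
    obtain ⟨x, hx⟩ := Option.isSome_iff_exists.1 hp
    refine ⟨leaf x, ?_⟩
    rintro (_ | ⟨s, p⟩)
    · simp [lookup, hx]
    · have : ¬ (φ (s :: p)).isSome := fun h => by simpa using hN _ h
      rw [Option.not_isSome_iff_eq_none.1 this, lookup]
  | succ N ih =>
    by_cases h0 : (φ []).isSome
    · obtain ⟨x, hx⟩ := Option.isSome_iff_exists.1 h0
      refine ⟨leaf x, ?_⟩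
      rintro (_ | ⟨s, p⟩)
      · simp [lookup, hx]
      · have : ¬ (φ (s :: p)).isSome := fun h => by
          simpa using hpf [] _ h0 h (List.nil_prefix)
        rw [Option.not_isSome_iff_eq_none.1 this, lookup]
    · have hU : {s | ∃ p, (φ (s :: p)).isSome}.Finite := by
        refine (hfin.image (fun p => p.head?)).preimage (f := some) (by simp) |>.subset ?_
        rintro s ⟨p, hp⟩
        exact ⟨s :: p, hp, rfl⟩
      have hc : ∀ s : hU.toFinset, ∃ t : DtryTree Sym X, ∀ p, t.lookup p = φ (s.1 :: p) := by
        intro s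
        refine ih (fun p => φ (s.1 :: p)) ?_ ?_ ?_ (hU.mem_toFinset.1 s.2)
        · intro p hp
          simpa using hN _ hp
        · exact hfin.preimage (f := fun p => s.1 :: p) (by intro a _ b _ h; simpa using h)
        · intro p q hp hq h
          simpa using hpf _ _ hp hq (List.cons_prefix_cons.2 ⟨rfl, h⟩)
      choose c hc using hc
      refine ⟨node hU.toFinset ?_ c, ?_⟩
      · obtain ⟨p, hp⟩ := hne
        rcases p with _ | ⟨s, p⟩
        · exact absurd hp h0
        · exact ⟨s, by simpa using ⟨p, hp⟩⟩
      · rintro (_ | ⟨s, p⟩)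
        · exact (Option.not_isSome_iff_eq_none.1 h0).symm
        · by_cases hs : s ∈ hU.toFinset
          · simp only [lookup, hs, dif_pos, hc]
          · have : ¬ (φ (s :: p)).isSome := fun h => hs (by simpa using ⟨p, h⟩)
            simp only [lookup, hs, dif_neg, not_false_eq_true]
            exact (Option.not_isSome_iff_eq_none.1 this).symm

theorem lookup_bind (f : X → DtryTree Sym Z) (t : DtryTree Sym X) (p : List Sym) (z : Z) :
    (t.bind f).lookup p = some z ↔
      ∃ n m x, p = n ++ m ∧ t.lookup n = some x ∧ (f x).lookup m = some z := by
  induction t generalizing p with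
  | leaf x =>
    constructor
    · intro h
      exact ⟨[], p, x, rfl, rfl, h⟩
    · rintro ⟨n, m, y, rfl, h1, h2⟩
      cases n with
      | nil =>
        obtain rfl : x = y := by simpa [lookup] using h1
        exact h2
      | cons => simp [lookup] at h1
  | node U hU child ih =>
    constructor
    · intro h
      rcases p with _ | ⟨s, p⟩
      · simp [bind, lookup] at h
      by_cases hs : s ∈ U
      · simp only [bind, lookup, hs, dif_pos] at h
        obtain ⟨n, m, x, rfl, h1, h2⟩ := (ih _ _).1 h
        exact ⟨s :: n, m, x, rfl, by simpa [lookup, hs] using h1, h2⟩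
      · simp [bind, lookup, hs] at h
    · rintro ⟨n, m, y, rfl, h1, h2⟩
      rcases n with _ | ⟨s, n⟩
      · simp [lookup] at h1
      by_cases hs : s ∈ U
      · simp only [lookup, hs, dif_pos] at h1
        simpa [bind, lookup, hs] using (ih ⟨s, hs⟩ _).2 ⟨n, m, y, rfl, h1, h2⟩
      · simp [lookup, hs] at h1

theorem lookup_distrib (t : DtryTree Sym (Option X)) (p : List Sym) :
    lookupMaybe t.distrib p = (t.lookup p).join := by
  classical
  induction t generalizing p with
  | leaf o => cases o <;> cases p <;> simp [lookupMaybe, lookup, distrib]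
  | node U hU child ih =>
    rcases p with _ | ⟨s, p⟩
    · simp only [distrib]
      split_ifs <;> simp [lookupMaybe, lookup]
    by_cases hs : s ∈ U
    · have key := ih ⟨s, hs⟩ p
      simp only [distrib]
      by_cases hsome : (child ⟨s, hs⟩).distrib.isSome
      · have hmem : s ∈ U.filter (fun s => ∃ hs : s ∈ U, (child ⟨s, hs⟩).distrib.isSome) :=
          Finset.mem_filter.2 ⟨hs, hs, hsome⟩
        rw [dif_pos ⟨s, hmem⟩]
        obtain ⟨t', ht'⟩ := Option.isSome_iff_exists.1 hsome
        simp only [lookupMaybe, Option.bind_some, lookup, hmem, hs, dif_pos, ← key, ht', Option.get_some]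
      · have hmem : s ∉ U.filter (fun s => ∃ hs : s ∈ U, (child ⟨s, hs⟩).distrib.isSome) :=
          fun h => hsome (Finset.mem_filter.1 h).2.2
        have h0 : (child ⟨s, hs⟩).distrib = none := by simpa using hsome
        simp only [lookup, hs, dif_pos, ← key, h0]
        split_ifs
        · simp only [lookupMaybe, Option.bind_some, lookup, hmem, dif_neg, not_false_eq_true,
            Option.bind_none]
        · rfl
    · have hmem : s ∉ U.filter (fun s => ∃ hs : s ∈ U, (child ⟨s, hs⟩).distrib.isSome) :=
        fun h => hs (Finset.mem_filter.1 h).1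
      simp only [distrib, lookup, hs, dif_neg, not_false_eq_true, Option.join_none]
      split_ifs
      · simp only [lookupMaybe, Option.bind_some, lookup, hmem, dif_neg, not_false_eq_true]
      · rfl

theorem lookupMaybe_finite (o : Option (DtryTree Sym X)) : {p | (lookupMaybe o p).isSome}.Finite := by
  cases o with
  | none => simp [lookupMaybe]
  | some t => exact t.lookup_finite

/-- The directory with the complete paths and contents of a tree (or with no paths at all). -/
def toDtry (o : Option (DtryTree Sym X)) : Dtry Sym X where
  dom := (lookupMaybe_finite o).toFinset
  prefixFree := by
    cases o with
    | none => simp [PrefixFree, lookupMaybe]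
    | some t =>
      intro p hp q hq h
      exact t.lookup_prefix (by simpa [lookupMaybe] using hp) (by simpa [lookupMaybe] using hq) h
  val p := (lookupMaybe o p.1).get ((lookupMaybe_finite o).mem_toFinset.1 p.2)

open scoped Classical in
/-- The content of a directory at a path, if there is one. -/
def _root_.Dtry.lookup (Y : Dtry Sym X) (p : List Sym) : Option X :=
  if h : p ∈ Y.dom then some (Y.val ⟨p, h⟩) else none

theorem _root_.Dtry.lookup_ext {Y Y' : Dtry Sym X} (h : ∀ p, Y.lookup p = Y'.lookup p) : Y = Y' := by
  have hd : Y.dom = Y'.dom := by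
    ext p
    have := congrArg Option.isSome (h p)
    by_cases h1 : p ∈ Y.dom <;> by_cases h2 : p ∈ Y'.dom <;> simp_all [Dtry.lookup]
  refine Dtry.ext_val hd fun p hp hp' => ?_
  simpa [Dtry.lookup, hp, hp'] using h p

theorem lookup_toDtry (o : Option (DtryTree Sym X)) (p : List Sym) :
    (toDtry o).lookup p = lookupMaybe o p := by
  by_cases h : (lookupMaybe o p).isSome
  · have : p ∈ (toDtry o).dom := by simpa [toDtry] using h
    rw [Dtry.lookup, dif_pos this]
    exact Option.some_get ((lookupMaybe_finite o).mem_toFinset.1 this)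
  · have : p ∉ (toDtry o).dom := by simpa [toDtry] using h
    rw [Dtry.lookup, dif_neg this, Option.not_isSome_iff_eq_none.1 h]

/-- Directories are the same as elements of `Maybe ∘ DtryTree`, the free monad on `Record_{≠∅}`
composed with `Maybe`. -/
theorem toDtry_bijective : Function.Bijective (toDtry (Sym := Sym) (X := X)) := by
  constructor
  · intro o o' h
    have h : ∀ p, lookupMaybe o p = lookupMaybe o' p := fun p => by
      rw [← lookup_toDtry, ← lookup_toDtry, h]
    rcases o with _ | t <;> rcases o' with _ | t'
    · rfl
    · obtain ⟨p, hp⟩ := t'.exists_lookup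
      simp [← show none = t'.lookup p from h p] at hp
    · obtain ⟨p, hp⟩ := t.exists_lookup
      simp [show t.lookup p = none from h p] at hp
    · exact congrArg some (lookup_injective h)
  · intro Y
    have hmem : ∀ p, (Y.lookup p).isSome ↔ p ∈ Y.dom := fun p => by
      by_cases h : p ∈ Y.dom <;> simp [Dtry.lookup, h]
    by_cases hne : ∃ p, p ∈ Y.dom
    · obtain ⟨t, ht⟩ := exists_tree (Y.dom.sup List.length) Y.lookup
        (fun p hp => Finset.le_sup (f := List.length) ((hmem p).1 hp))
        (by simp [hmem])
        (fun p q hp hq => Y.prefixFree _ ((hmem p).1 hp) _ ((hmem q).1 hq))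
        (by simpa [hmem] using hne)
      exact ⟨some t, Dtry.lookup_ext fun p => (lookup_toDtry _ _).trans (ht p)⟩
    · refine ⟨none, Dtry.lookup_ext fun p => (lookup_toDtry _ _).trans ?_⟩
      have : p ∉ Y.dom := fun h => hne ⟨p, h⟩
      simp [Dtry.lookup, this, lookupMaybe]

/-- The bijection is compatible with the units. -/
theorem toDtry_leaf (x : X) : toDtry (some (leaf x : DtryTree Sym X)) = Dtry.pure x := by
  refine Dtry.lookup_ext fun p => (lookup_toDtry _ _).trans ?_
  cases p <;> simp [lookupMaybe, lookup, Dtry.lookup]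

theorem _root_.Dtry.lookup_join (Y : Dtry Sym (Dtry Sym X)) (p : List Sym) (x : X) :
    Y.join.lookup p = some x ↔
      ∃ n m Y', p = n ++ m ∧ Y.lookup n = some Y' ∧ Y'.lookup m = some x := by
  constructor
  · intro h
    by_cases hp : p ∈ Y.join.dom
    · refine ⟨_, _, _, ?_, dif_pos (Y.split ⟨p, hp⟩).1.2, (dif_pos (Y.split ⟨p, hp⟩).2.2).trans ?_⟩
      · rw [← Dtry.split_symm_val, Equiv.symm_apply_apply]
      · simpa [Dtry.lookup, hp, Dtry.join_val] using h
    · simp [Dtry.lookup, hp] at h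
  · rintro ⟨n, m, Y', rfl, h1, h2⟩
    by_cases hn : n ∈ Y.dom
    · obtain rfl : Y.val ⟨n, hn⟩ = Y' := by simpa [Dtry.lookup, hn] using h1
      by_cases hm : m ∈ (Y.val ⟨n, hn⟩).dom
      · have hp := (Y.split.symm ⟨⟨n, hn⟩, ⟨m, hm⟩⟩).2
        rw [Dtry.split_symm_val] at hp
        have e : Y.split ⟨n ++ m, hp⟩ = ⟨⟨n, hn⟩, ⟨m, hm⟩⟩ :=
          Y.split.symm.injective (by rw [Equiv.symm_apply_apply]; rfl)
        have h2 : (Y.val ⟨n, hn⟩).val ⟨m, hm⟩ = x := by simpa [Dtry.lookup, hm] using h2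
        rw [Dtry.lookup, dif_pos hp, Dtry.join_val, e, h2]
      · simp [Dtry.lookup, hm] at h2
    · simp [Dtry.lookup, hn] at h1

/-- The bijection is natural. -/
theorem toDtry_map (f : X → Z) (o : Option (DtryTree Sym X)) :
    toDtry (o.map (fun t => t.bind (fun x => leaf (f x)))) = (toDtry o).map f := by
  refine Dtry.lookup_ext fun p => (lookup_toDtry _ _).trans (Option.ext fun z => ?_)
  have e : ((toDtry o).map f).lookup p = ((toDtry o).lookup p).map f := by
    by_cases h : p ∈ (toDtry o).dom <;> simp [Dtry.lookup, h]
  rw [e, lookup_toDtry]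
  cases o with
  | none => simp [lookupMaybe]
  | some t =>
    simp only [lookupMaybe, Option.map_some, Option.bind_some, lookup_bind]
    constructor
    · rintro ⟨n, m, x, rfl, h1, h2⟩
      cases m with
      | nil => simpa [h1, lookup] using h2
      | cons => simp [lookup] at h2
    · intro h
      obtain ⟨x, h1, rfl⟩ := Option.map_eq_some_iff.1 h
      exact ⟨p, [], x, by simp, h1, rfl⟩

/-- The bijection is compatible with the multiplications. -/
theorem toDtry_flatten (o : Option (DtryTree Sym (Option (DtryTree Sym X)))) :
    toDtry (flatten o) = ((toDtry o).map toDtry).join := by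
  refine Dtry.lookup_ext fun p => (lookup_toDtry _ _).trans (Option.ext fun x => ?_)
  rw [Dtry.lookup_join]
  have e : ∀ n, ((toDtry o).map toDtry).lookup n = (lookupMaybe o n).map toDtry := fun n => by
    rw [← lookup_toDtry]
    by_cases h : n ∈ (toDtry o).dom <;> simp [Dtry.lookup, h]
  simp only [e, Option.map_eq_some_iff]
  cases o with
  | none => simp [flatten, lookupMaybe]
  | some t =>
    have h1 : lookupMaybe (flatten (some t)) p = some x ↔
        ∃ n m t', p = n ++ m ∧ lookupMaybe t.distrib n = some t' ∧ t'.lookup m = some x := by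
      cases ht : t.distrib with
      | none => simp [flatten, ht, lookupMaybe]
      | some s => simp [flatten, ht, lookupMaybe, lookup_bind]
    rw [h1]
    simp only [lookup_distrib, Option.join_eq_some_iff]
    constructor
    · rintro ⟨n, m, t', rfl, h2, h3⟩
      exact ⟨n, m, _, rfl, ⟨some t', h2, rfl⟩, (lookup_toDtry _ _).trans h3⟩
    · rintro ⟨n, m, _, rfl, ⟨_ | t', h2, rfl⟩, h3⟩ <;> rw [lookup_toDtry] at h3
      · simp [lookupMaybe] at h3
      · exact ⟨n, m, t', rfl, h2, h3⟩

end DtryTree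

/-! ## The 2-categorical lift `Dtry₀` and the category of directories -/

namespace Dtry

variable {Sym : Type w} {C : Type u}

/-- Transport of paths along an equality of path sets. -/
def castDom {Y Z : Dtry Sym C} (h : Y.dom = Z.dom) (p : Y.dom) : Z.dom := ⟨p.1, h ▸ p.2⟩

variable [Category.{v} C]

/-- A directory of arrows of `C` with source `Y` and target `Z`: it exists only if `Y` and `Z` have
the same paths, and then consists of one arrow of `C` for each path. -/
structure Hom (Y Z : Dtry Sym C) where
  dom_eq : Y.dom = Z.dom
  app (p : Y.dom) : Y.val p ⟶ Z.val (castDom dom_eq p)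

/-- The category `Dtry₀ C`: directories of objects and directories of arrows of `C`. -/
instance zeroCategory : Category.{max w v} (Dtry Sym C) where
  Hom Y Z := Hom Y Z
  id Y := ⟨rfl, fun p => 𝟙 (Y.val p)⟩
  comp f g := ⟨f.dom_eq.trans g.dom_eq, fun p => f.app p ≫ g.app (castDom f.dom_eq p)⟩
  id_comp f := congrArg (Hom.mk f.dom_eq) (funext fun _ => Category.id_comp _)
  comp_id f := congrArg (Hom.mk f.dom_eq) (funext fun _ => Category.comp_id _)
  assoc f g h := congrArg (Hom.mk (f.dom_eq.trans (g.dom_eq.trans h.dom_eq)))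
    (funext fun _ => Category.assoc _ _ _)

end Dtry

section

variable (Sym : Type w) (C : Type u) [Category.{v} C]

/-- `PathFamily : Dtry₀ C ⥤ FinFam C` sends a directory to the family of its contents, indexed by its
complete paths. -/
def pathFamily : Dtry Sym C ⥤ FinFam.{w} C where
  obj Y := FinFam.of Y.val
  map f := FinFam.homMk (Dtry.castDom f.dom_eq) f.app

/-- The category of directories in `C`: the middle category of the bo-ff factorization of
`PathFamily`. Its objects are directories of objects of `C`; an arrow `Y ⟶ Z` is a function from the
paths of `Y` to those of `Z` with an arrow `Y.val p ⟶ Z.val (f p)` for every path `p` of `Y`. -/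
abbrev DtryCat : Type (max w u) := BoFF (pathFamily Sym C)

end

namespace DtryCat

variable {Sym : Type w} {C : Type u} [Category.{v} C] {D : Type u₁} [Category.{v₁} D]

/-- The function on paths of an arrow. -/
abbrev idx {Y Z : DtryCat Sym C} (g : Y ⟶ Z) : Y.obj.dom → Z.obj.dom := g.hom.hom.f

/-- The components of an arrow. -/
abbrev arr {Y Z : DtryCat Sym C} (g : Y ⟶ Z) (p : Y.obj.dom) :
    Y.obj.val p ⟶ Z.obj.val (idx g p) := g.hom.hom.φ p

/-- The arrow with given function on paths and given components. -/
abbrev homMk {Y Z : DtryCat Sym C} (f : Y.obj.dom → Z.obj.dom)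
    (φ : ∀ p, Y.obj.val p ⟶ Z.obj.val (f p)) : Y ⟶ Z :=
  BoFF.Hom.mk (FinFam.homMk f φ)

variable (Sym) in
/-- The action on functors: `(d, X) ↦ (d, X ⋙ F)`, `(f₀, f₁) ↦ (f₀, F f₁)`. -/
def map (F : C ⥤ D) : DtryCat Sym C ⥤ DtryCat Sym D where
  obj Y := ⟨Y.obj.map F.obj⟩
  map {Y Z} g := homMk (Y := ⟨Y.obj.map F.obj⟩) (Z := ⟨Z.obj.map F.obj⟩)
    (idx g :) (fun p => F.map (arr g p :))
  map_id Y := congrArg (homMk (Y := ⟨Y.obj.map F.obj⟩) (Z := ⟨Y.obj.map F.obj⟩) id)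
    (funext fun _ => F.map_id _)
  map_comp {Y _ Z} g h := congrArg
    (homMk (Y := ⟨Y.obj.map F.obj⟩) (Z := ⟨Z.obj.map F.obj⟩) (idx (g ≫ h) :))
    (funext fun _ => F.map_comp _ _)

variable (Sym) in
/-- The action on natural transformations: the identity on paths, with component `α (X p)` at the
path `p`. -/
def map₂ {F G : C ⥤ D} (α : F ⟶ G) : map Sym F ⟶ map Sym G where
  app Y := homMk (Y := ⟨Y.obj.map F.obj⟩) (Z := ⟨Y.obj.map G.obj⟩)
    id (fun p => α.app (Y.obj.val p))
  naturality {Y Z} g := congrArg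
    (homMk (Y := ⟨Y.obj.map F.obj⟩) (Z := ⟨Z.obj.map G.obj⟩) (idx g :))
    (funext fun p => α.naturality (arr g p :))

variable (Sym C) in
/-- The unit functor. -/
def unit : C ⥤ DtryCat Sym C where
  obj X := ⟨Dtry.pure X⟩
  map {X Z} f := homMk (Y := ⟨Dtry.pure X⟩) (Z := ⟨Dtry.pure Z⟩) id (fun _ => f)

/-- The directory of directories underlying an object of `DtryCat Sym (DtryCat Sym C)`. -/
abbrev nested (Y : DtryCat Sym (DtryCat Sym C)) : Dtry Sym (Dtry Sym C) := Y.obj.map BoFF.obj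

/-- The effect of an arrow of directories of directories on pairs of paths. -/
def pairsMap {Y Z : DtryCat Sym (DtryCat Sym C)} (g : Y ⟶ Z) (x : Y.nested.Pairs) :
    Z.nested.Pairs :=
  ⟨idx (Y := Y) (Z := Z) g x.1, idx (arr (Y := Y) (Z := Z) g x.1) x.2⟩

variable (Sym C) in
/-- The functor sending a directory of directories to the family of its contents indexed by the
pairs `(n, m)` of paths. -/
def pairsFamily : DtryCat Sym (DtryCat Sym C) ⥤ FinFam.{w} C where
  obj Y := FinFam.of (fun x : Y.nested.Pairs => (Y.nested.val x.1).val x.2)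
  map {Y Z} g := FinFam.homMk (X := FinFam.of _) (Y := FinFam.of _) (pairsMap g)
    (fun x => arr (arr (Y := Y) (Z := Z) g x.1) x.2)

/-- Reindexing the contents of the joined directory along the bijection `n ++ m ↦ (n, m)`. -/
def joinIso (Y : DtryCat Sym (DtryCat Sym C)) :
    (pathFamily Sym C).obj Y.nested.join ≅ (pairsFamily Sym C).obj Y :=
  ObjectProperty.isoMk _ (FormalCoproduct.isoOfComponents
    (X := ⟨Y.nested.join.dom, Y.nested.join.val⟩)
    (Y := ⟨Y.nested.Pairs, fun x => (Y.nested.val x.1).val x.2⟩)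
    Y.nested.split (fun _ => Iso.refl _))

variable (Sym C) in
/-- The multiplication functor: `join` on objects; an arrow `g` is sent to the arrow that takes the
path `n ++ m` to `g n ++ (g at n) m`, with the components of `g`. -/
def mult : DtryCat Sym (DtryCat Sym C) ⥤ DtryCat Sym C where
  obj Y := ⟨Y.nested.join⟩
  map {Y Z} g := BoFF.Hom.mk ((joinIso Y).hom ≫ (pairsFamily Sym C).map g ≫ (joinIso Z).inv)
  map_id Y := by
    ext1
    simp [BoFF.id_hom]
  map_comp g h := by
    ext1
    simp [BoFF.comp_hom]

/-- The operations of the 2-monad of directories on `Cat`. -/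
def twoMonadData (Sym : Type w) : TwoMonadData Cat.{max v w, max u w} where
  obj C := Cat.of (DtryCat Sym C)
  map F := (map Sym F.toFunctor).toCatHom
  map₂ α := (map₂ Sym α.toNatTrans).toCatHom₂
  unit C := (unit Sym C).toCatHom
  mult C := (mult Sym C).toCatHom

end DtryCat

/-! ## The route through `FinFam₌` -/

section Lex

variable (Sym : Type w) [LinearOrder Sym] (C : Type u) [Category.{v} C]

/-- The contents of a directory, listed in the lexicographic order of the paths. -/
def Dtry.lexFamily {Sym : Type w} [LinearOrder Sym] {C : Type u} (Y : Dtry Sym C) :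
    StdFamily C where
  n := Y.dom.card
  val i := Y.val (Y.dom.orderIsoOfFin rfl i)

/-- The isomorphism of families given by the lexicographic enumeration of the paths. -/
def Dtry.lexIso {Sym : Type w} [LinearOrder Sym] {C : Type u} [Category.{v} C]
    (Y : Dtry Sym C) : Y.lexFamily.family ≅ (pathFamily Sym C).obj Y :=
  ObjectProperty.isoMk _ (FormalCoproduct.isoOfComponents
    (X := ⟨ULift (Fin Y.dom.card), fun i => Y.val (Y.dom.orderIsoOfFin rfl i.down)⟩)
    (Y := ⟨Y.dom, Y.val⟩)
    (Equiv.ulift.trans (Y.dom.orderIsoOfFin rfl).toEquiv) (fun _ => Iso.refl _))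

/-- The functor `Dtry₀ C ⥤ FinFam₌ C` induced by the lexicographic order on paths. -/
def pathFamilyLex : Dtry Sym C ⥤ FinFamEq.{w} C where
  obj Y := Y.lexFamily
  map {Y Z} f := InducedCategory.homMk
    (Y.lexIso.hom ≫ (pathFamily Sym C).map f ≫ Z.lexIso.inv)
  map_id Y := by
    ext1
    simp
  map_comp f g := by
    ext1
    simp

end Lex

end

/-! The monad laws for directories reduce to the monoid laws for concatenation of paths. A complete
path of a joined directory decomposes as `n ++ m` in exactly one way, by prefix-freeness, so both a
directory and an arrow are determined by what they do on such decompositions. On objects,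
`Dtry.lookup_ext` and `Dtry.lookup_join` turn the laws into `[] ++ p = p`, `p ++ [] = p` and
associativity of `++`. On arrows, `mult_map_spec` computes `mult` from any decomposition of a path,
and the same three list identities give the laws again.

The difficulty is strictness. `Dtry.join` finds its decomposition by choice, so the content at `n ++
m` is the expected object only propositionally. Arrows are therefore compared by heterogeneous
equality, path by path (`hom_heq`), and `Functor.hext` then yields equalities of functors.

For the lexicographic route, both middle categories have the directories as objects, and their
hom-sets correspond by conjugation with the isomorphisms `Dtry.lexIso`. -/

noncomputable section

/-! ### Heterogeneous equality of arrows and 2-cells; conjugation by isomorphisms. -/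

section General

variable {C : Type u} [Category.{v} C] {D : Type u} [Category.{v} D]

theorem functor_map_heq (F : C ⥤ D) {X X' Y Y' : C} (hX : X = X') (hY : Y = Y')
    {f : X ⟶ Y} {f' : X' ⟶ Y'} (h : f ≍ f') : F.map f ≍ F.map f' := by
  subst hX hY
  rw [eq_of_heq h]

/-- The 2-cell axioms of strict 2-functors and of `StrictTwoNatTrans` are phrased with `eqToHom` on
both sides; this reduces them to a single heterogeneous equality. -/
theorem eq_eqToHom_comp_comp {K : Type u₁} [Category.{v₁} K] {a b c d : K} {f : a ⟶ d} {g : b ⟶ c}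
    (h : a = b) (h' : c = d) (H : f ≍ g) : f = eqToHom h ≫ g ≫ eqToHom h' := by
  subst h h'
  simpa using H

theorem toCatHom₂_heq {F F' G G' : C ⥤ D} {α : F ⟶ G} {α' : F' ⟶ G'} (hF : F = F') (hG : G = G')
    (h : ∀ X, α.app X ≍ α'.app X) : α.toCatHom₂ ≍ α'.toCatHom₂ := by
  subst hF hG
  obtain rfl : α = α' := NatTrans.ext (funext fun X => eq_of_heq (h X))
  rfl

theorem homCongr_id {X Y : C} (e : X ≅ Y) : e.homCongr e (𝟙 X) = 𝟙 Y := by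
  simp [Iso.homCongr]

theorem homCongr_symm_comp_hom {X Y X' Y' : C} (e : X ≅ X') (e' : Y ≅ Y') (f : X' ⟶ Y') :
    e.symm.homCongr e'.symm f ≫ e'.hom = e.hom ≫ f := by
  simp [Iso.homCongr]

end General

/-! ### Monad laws for directories in a set. -/

namespace Dtry

variable {Sym : Type w} {X : Type u}

/-- Concatenation is injective on pairs, so any exhibited decomposition of a path agrees with the
one picked by choice in `join`. Later arguments can thus choose convenient decompositions. -/
theorem split_eq (Y : Dtry Sym (Dtry Sym X)) (p : Y.join.dom) (x : Y.Pairs)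
    (h : p.1 = x.1.1 ++ x.2.1) : Y.split p = x :=
  Y.split.symm.injective (Subtype.ext (by rw [Equiv.symm_apply_apply, h, split_symm_val]))

theorem join_val_eq (Y : Dtry Sym (Dtry Sym X)) (p : Y.join.dom) (x : Y.Pairs)
    (h : p.1 = x.1.1 ++ x.2.1) : Y.join.val p = (Y.val x.1).val x.2 := by
  rw [join_val, Y.split_eq p x h]

theorem exists_pair (Y : Dtry Sym (Dtry Sym X)) (p : Y.join.dom) :
    ∃ x : Y.Pairs, p.1 = x.1.1 ++ x.2.1 :=
  ⟨Y.split p, by rw [← split_symm_val, Equiv.symm_apply_apply]⟩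

theorem lookup_pure (x : X) (p : List Sym) (y : X) :
    (pure x : Dtry Sym X).lookup p = some y ↔ p = [] ∧ x = y := by
  by_cases hp : p = [] <;> simp [lookup, hp]

theorem lookup_map {X' : Type u₁} (F : X → X') (Y : Dtry Sym X) (p : List Sym) :
    (Y.map F).lookup p = (Y.lookup p).map F := by
  by_cases h : p ∈ Y.dom <;> simp [lookup, h]

theorem join_pure (Y : Dtry Sym X) : (pure Y).join = Y :=
  lookup_ext fun p => Option.ext fun x => by simp [lookup_join, lookup_pure]

theorem join_map_pure (Y : Dtry Sym X) : (Y.map pure).join = Y := by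
  refine lookup_ext fun p => Option.ext fun x => ?_
  simp only [lookup_join, lookup_map, Option.map_eq_some_iff]
  constructor
  · rintro ⟨n, m, _, rfl, ⟨y, hy, rfl⟩, h⟩
    obtain ⟨rfl, rfl⟩ := (lookup_pure _ _ _).1 h
    simpa using hy
  · exact fun h => ⟨p, [], _, (List.append_nil p).symm, ⟨x, h, rfl⟩,
      (lookup_pure _ _ _).2 ⟨rfl, rfl⟩⟩

/-- On either side a content is reached through a triple of paths `n`, `m`, `k`, bracketed as `(n ++
m) ++ k` on the left and `n ++ (m ++ k)` on the right. -/
theorem join_join (Y : Dtry Sym (Dtry Sym (Dtry Sym X))) :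
    Y.join.join = (Y.map join).join := by
  refine lookup_ext fun p => Option.ext fun x => ?_
  simp only [lookup_join, lookup_map, Option.map_eq_some_iff]
  constructor
  · rintro ⟨_, k, D, rfl, ⟨n, m, E, rfl, hE, hD⟩, hx⟩
    exact ⟨n, m ++ k, _, List.append_assoc _ _ _, ⟨E, hE, rfl⟩,
      (E.lookup_join _ _).2 ⟨m, k, D, rfl, hD, hx⟩⟩
  · rintro ⟨n, _, _, rfl, ⟨E, hE, rfl⟩, h⟩
    obtain ⟨m, k, D, rfl, hD, hx⟩ := (E.lookup_join _ _).1 h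
    exact ⟨n ++ m, k, D, (List.append_assoc _ _ _).symm, ⟨n, m, E, rfl, hE, hD⟩, hx⟩

end Dtry

/-! ### Naturality and monad laws for directories in a category. -/

namespace DtryCat

variable {Sym : Type w} {C : Type u} [Category.{v} C] {D : Type u} [Category.{v} D]

theorem arr_heq {Y Y' Z Z' : DtryCat Sym C} (hY : Y = Y') (hZ : Z = Z')
    {f : Y ⟶ Z} {f' : Y' ⟶ Z'}
    (h : f ≍ f') {p : Y.obj.dom} {p' : Y'.obj.dom} (hp : p.1 = p'.1) :
    (idx f p).1 = (idx f' p').1 ∧ arr f p ≍ arr f' p' := by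
  subst hY hZ
  obtain rfl := eq_of_heq h
  obtain rfl := Subtype.ext hp
  exact ⟨rfl, HEq.rfl⟩

/-- Comparing paths as bare lists avoids casts between the path sets of directories that are only
propositionally equal. -/
theorem hom_heq {Y Y' Z Z' : DtryCat Sym C} (hY : Y = Y') (hZ : Z = Z')
    {f : Y ⟶ Z} {f' : Y' ⟶ Z'}
    (h : ∀ (p : Y.obj.dom) (p' : Y'.obj.dom), p.1 = p'.1 →
      (idx f p).1 = (idx f' p').1 ∧ arr f p ≍ arr f' p') : f ≍ f' := by
  subst hY hZ
  obtain ⟨⟨⟨f, φ⟩⟩⟩ := f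
  obtain ⟨⟨⟨f', φ'⟩⟩⟩ := f'
  obtain rfl : f = f' := funext fun p => Subtype.ext (h p p rfl).1
  obtain rfl : φ = φ' := funext fun p => eq_of_heq (h p p rfl).2
  rfl

/-- The multiplication on arrows, at a path `n ++ m`. -/
theorem mult_map_spec {Y Z : DtryCat Sym (DtryCat Sym C)} (g : Y ⟶ Z)
    (p : ((mult Sym C).obj Y).obj.dom) (x : Y.nested.Pairs) (h : p.1 = x.1.1 ++ x.2.1) :
    (idx ((mult Sym C).map g) p).1 =
        (idx g x.1).1 ++ (idx (arr g x.1) x.2).1 ∧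
      arr ((mult Sym C).map g) p ≍ arr (arr g x.1) x.2 := by
  obtain rfl := Y.nested.split_eq p x h
  refine ⟨rfl, ?_⟩
  -- The identities come from the components of the two `joinIso`s. The `eqToHom` arises from
  -- inverting the second one, because splitting a concatenation returns the original pair only
  -- propositionally.
  change 𝟙 _ ≫ arr (arr g _) _ ≫ eqToHom _ ≫ 𝟙 _ ≍ _
  rw [Category.id_comp, Category.comp_id]
  exact comp_eqToHom_heq _ _

theorem map_comp_mult (F : C ⥤ D) :
    map Sym (map Sym F) ⋙ mult Sym D = mult Sym C ⋙ map Sym F := by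
  -- The objects agree definitionally: the decomposition chosen by `join` depends on the path sets
  -- alone, which `F` leaves unchanged.
  refine Functor.hext (fun _ => rfl) fun Y Z g => hom_heq rfl rfl fun p p' hp => ?_
  obtain rfl := Subtype.ext hp
  obtain ⟨x, hx⟩ := Y.nested.exists_pair p
  have h₁ := mult_map_spec ((map Sym (map Sym F)).map g) p x hx
  have h₂ := mult_map_spec g p x hx
  exact ⟨h₁.1.trans h₂.1.symm, h₁.2.trans (functor_map_heq F (Y.nested.join_val_eq p x hx).symm
    (Z.nested.join_val_eq _ (pairsMap g x) h₂.1).symm h₂.2.symm)⟩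

/-- This is the 2-cell part of the 2-naturality of `mult`: both arrows fix every path `n ++ m` and
have there the component of `α` at the same object. -/
theorem mult_map_map₂_app {F G : C ⥤ D} (α : F ⟶ G) (Y : DtryCat Sym (DtryCat Sym C)) :
    (mult Sym D).map ((map₂ Sym (map₂ Sym α)).app Y) ≍
      (map₂ Sym α).app ((mult Sym C).obj Y) := by
  refine hom_heq rfl rfl fun p p' hp => ?_
  obtain rfl := Subtype.ext hp
  obtain ⟨x, hx⟩ := Y.nested.exists_pair p
  have h := mult_map_spec ((map₂ Sym (map₂ Sym α)).app Y) p x hx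
  refine ⟨h.1.trans hx.symm, h.2.trans ?_⟩
  change α.app ((Y.nested.val x.1).val x.2) ≍ α.app (Y.nested.join.val p)
  rw [Y.nested.join_val_eq p x hx]

theorem unit_comp_mult :
    unit Sym (DtryCat Sym C) ⋙ mult Sym C = 𝟭 _ := by
  have hobj (Y) : (unit Sym (DtryCat Sym C) ⋙ mult Sym C).obj Y = Y :=
    congrArg BoFF.of Y.obj.join_pure
  refine Functor.hext hobj fun Y Z g => hom_heq (hobj Y) (hobj Z) fun p p' hp => ?_
  -- The decomposition is `[] ++ p'`, which reduces to `p'` by definition; in the other unit law `p'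
  -- ++ []` needs `List.append_nil`.
  exact mult_map_spec ((unit Sym _).map g) p ⟨⟨[], Finset.mem_singleton_self _⟩, p'⟩ hp

theorem map_unit_comp_mult :
    map Sym (unit Sym C) ⋙ mult Sym C = 𝟭 _ := by
  have hobj (Y) : (map Sym (unit Sym C) ⋙ mult Sym C).obj Y = Y :=
    congrArg BoFF.of Y.obj.join_map_pure
  refine Functor.hext hobj fun Y Z g => hom_heq (hobj Y) (hobj Z) fun p p' hp => ?_
  have h := mult_map_spec ((map Sym (unit Sym C)).map g) p
    ⟨p', ⟨[], Finset.mem_singleton_self _⟩⟩ (hp.trans (List.append_nil _).symm)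
  exact ⟨h.1.trans (List.append_nil _), h.2⟩

theorem mult_comp_mult :
    mult Sym (DtryCat Sym C) ⋙ mult Sym C = map Sym (mult Sym C) ⋙ mult Sym C := by
  have hobj (Y) : (mult Sym (DtryCat Sym C) ⋙ mult Sym C).obj Y =
      (map Sym (mult Sym C) ⋙ mult Sym C).obj Y :=
    congrArg BoFF.of (Y.nested.map (Dtry.map BoFF.obj)).join_join
  refine Functor.hext hobj fun Y Z g => hom_heq (hobj Y) (hobj Z) fun p p' hp => ?_
  -- With `p = (n ++ m) ++ k`, the pair `x` is `(n ++ m, k)` and `y` is `(n, m)`; `z` below is `(m,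
  -- k)`, inside the directory at `n`.
  obtain ⟨x, hx⟩ := ((mult Sym _).obj Y).nested.exists_pair p
  obtain ⟨y, hy⟩ := Y.nested.exists_pair x.1
  have h₁ := mult_map_spec ((mult Sym _).map g) p x hx
  have h₂ := mult_map_spec g x.1 y hy
  have hY := Y.nested.join_val_eq x.1 y hy
  have hk : x.2.1 ∈ ((Y.nested.val y.1).val y.2).obj.dom := hY ▸ x.2.2
  -- The component of the joined arrow at `n ++ m` is identified by `h₂` only up to heterogeneous
  -- equality, so its value at `k` has to be transported.
  have h₃ := arr_heq hY (Z.nested.join_val_eq _ (pairsMap g y) h₂.1) h₂.2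
    (p := x.2) (p' := ⟨x.2.1, hk⟩) rfl
  let z : (nested (Y.obj.val y.1)).Pairs := ⟨y.2, ⟨x.2.1, hk⟩⟩
  have hp' : p'.1 = y.1.1 ++ (y.2.1 ++ x.2.1) := by
    rw [← hp, hx, hy, List.append_assoc]
  -- The other bracketing: the outer `mult` splits the path as `n` and `m ++ k`, and `h₅` then
  -- splits `m ++ k` inside the directory at `n`.
  have h₄ := mult_map_spec ((map Sym (mult Sym C)).map g) p'
    ⟨y.1, (nested (Y.obj.val y.1)).split.symm z⟩ hp'
  have h₅ := mult_map_spec (arr g y.1) ((nested (Y.obj.val y.1)).split.symm z) z rfl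
  constructor
  · refine h₁.1.trans (Eq.trans ?_ h₄.1.symm)
    rw [h₂.1, h₃.1, List.append_assoc]
    exact congrArg _ h₅.1.symm
  · exact (h₁.2.trans h₃.2).trans (h₄.2.trans h₅.2).symm

/-- The strict 2-functor of directories on `Cat`. -/
def strictTwoFunctor (Sym : Type w) :
    StrictPseudofunctor Cat.{max v w, max u w} Cat.{max v w, max u w} :=
  StrictPseudofunctor.mk''
    { obj := fun C => Cat.of (DtryCat Sym C)
      map := fun F => (map Sym F.toFunctor).toCatHom
      map₂ := fun α => (map₂ Sym α.toNatTrans).toCatHom₂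
      map₂_id := fun _ => rfl
      map₂_comp := fun _ _ => rfl
      map_id := fun _ => rfl
      map_comp := fun _ _ => rfl
      -- Composition of 1-cells is preserved definitionally, so the coherence 2-cells are trivial.
      map₂_whisker_left := fun _ _ _ _ => eq_eqToHom_comp_comp _ _ (heq_of_eq rfl)
      map₂_whisker_right := fun _ _ => eq_eqToHom_comp_comp _ _ (heq_of_eq rfl) }

/-- The strict 2-monad of directories on `Cat`. -/
def strictTwoMonad (Sym : Type w) : StrictTwoMonad Cat.{max v w, max u w} where
  functor := strictTwoFunctor.{w, v, u} Sym
  unit :=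
    { app C := (unit Sym C).toCatHom
      naturality _ := rfl
      naturality₂ _ := eq_eqToHom_comp_comp _ _ (heq_of_eq rfl) }
  mult :=
    { app C := (mult Sym C).toCatHom
      naturality F := congrArg Functor.toCatHom (map_comp_mult F.toFunctor)
      naturality₂ {_ _ F G} α := eq_eqToHom_comp_comp _ _
        (toCatHom₂_heq (map_comp_mult F.toFunctor) (map_comp_mult G.toFunctor)
          (mult_map_map₂_app α.toNatTrans)) }
  unit_mult _ := congrArg Functor.toCatHom unit_comp_mult
  map_unit_mult _ := congrArg Functor.toCatHom map_unit_comp_mult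
  mult_mult _ := congrArg Functor.toCatHom mult_comp_mult

end DtryCat

/-! ### Comparison with the factorization through standard families. -/

section Lex

variable (Sym : Type w) [LinearOrder Sym] (C : Type u) [Category.{v} C]

/-- The comparison functor to the middle category of `pathFamilyLex`: the identity on objects, and
conjugation by the lexicographic enumerations on arrows. -/
def toLexCat : DtryCat Sym C ⥤ BoFF (pathFamilyLex Sym C) where
  obj Y := ⟨Y.obj⟩
  map {Y Z} f := ⟨InducedCategory.homMk (Y.obj.lexIso.symm.homCongr Z.obj.lexIso.symm f.hom)⟩
  map_id Y := BoFF.hom_ext (InducedCategory.hom_ext (homCongr_id Y.obj.lexIso.symm))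
  map_comp {X Y Z} f g := BoFF.hom_ext (InducedCategory.hom_ext
    (Iso.homCongr_comp X.obj.lexIso.symm Y.obj.lexIso.symm Z.obj.lexIso.symm f.hom g.hom))

/-- The inverse of `toLexCat`. -/
def ofLexCat : BoFF (pathFamilyLex Sym C) ⥤ DtryCat Sym C where
  obj Y := ⟨Y.obj⟩
  map {Y Z} f := ⟨Y.obj.lexIso.homCongr Z.obj.lexIso f.hom.hom⟩
  map_id Y := BoFF.hom_ext (homCongr_id Y.obj.lexIso)
  map_comp {X Y Z} f g := BoFF.hom_ext
    (Iso.homCongr_comp X.obj.lexIso Y.obj.lexIso Z.obj.lexIso f.hom.hom g.hom.hom)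

theorem toLexCat_comp_ofLexCat : toLexCat Sym C ⋙ ofLexCat Sym C = 𝟭 _ :=
  Functor.hext (fun _ => rfl) fun Y Z f => heq_of_eq (BoFF.hom_ext
    ((Y.obj.lexIso.symm.homCongr Z.obj.lexIso.symm).symm_apply_apply f.hom))

theorem ofLexCat_comp_toLexCat : ofLexCat Sym C ⋙ toLexCat Sym C = 𝟭 _ :=
  Functor.hext (fun _ => rfl) fun Y Z f => heq_of_eq (BoFF.hom_ext (InducedCategory.hom_ext
    ((Y.obj.lexIso.homCongr Z.obj.lexIso).symm_apply_apply f.hom.hom)))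

/-- The comparison functor commutes with the fully faithful parts up to isomorphism. -/
def toLexCatCompIso : toLexCat Sym C ⋙ BoFF.ff (pathFamilyLex Sym C) ⋙ FinFamEq.incl C ≅
    BoFF.ff (pathFamily Sym C) :=
  NatIso.ofComponents (fun Y => Y.obj.lexIso) fun {Y Z} f =>
    homCongr_symm_comp_hom Y.obj.lexIso Z.obj.lexIso f.hom

end Lex

end

theorem mainTheorem1 (Sym : Type w) :
    (∃ M : StrictTwoMonad Cat.{max v w, max u w},
      (∀ C : Cat.{max v w, max u w}, M.functor.obj C = Cat.of (DtryCat Sym C)) ∧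
      M.data = DtryCat.twoMonadData.{w, v, u} Sym) ∧
    (∀ [LinearOrder Sym] (C : Cat.{max v w, max u w}),
      ∃ (Φ : DtryCat Sym C ⥤ BoFF (pathFamilyLex Sym C))
        (Ψ : BoFF (pathFamilyLex Sym C) ⥤ DtryCat Sym C),
        Φ ⋙ Ψ = 𝟭 _ ∧ Ψ ⋙ Φ = 𝟭 _ ∧
        BoFF.bo (pathFamily Sym C) ⋙ Φ = BoFF.bo (pathFamilyLex Sym C) ∧
        Nonempty (Φ ⋙ BoFF.ff (pathFamilyLex Sym C) ⋙ FinFamEq.incl C ≅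
          BoFF.ff (pathFamily Sym C))) :=
  ⟨⟨DtryCat.strictTwoMonad.{w, v, u} Sym, fun _ => rfl, rfl⟩, fun C =>
    -- The triangle of bijective-on-objects functors commutes by `rfl`, since `pathFamilyLex` is
    -- itself `pathFamily` conjugated by `Dtry.lexIso`.
    ⟨toLexCat Sym C, ofLexCat Sym C, toLexCat_comp_ofLexCat Sym C, ofLexCat_comp_toLexCat Sym C, rfl,
      ⟨toLexCatCompIso Sym C⟩⟩⟩
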